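/- Let $S(\mathbb R^d)$ be the Schwartz space of complex-valued functions and let $\theta$ be a symplectic form on $\mathbb R^d$, i.e. a nondegenerate skew-symmetric real bilinear form. Let $E$ be a complete nuclear barrelled locally convex space which is a vector subspace of $S(\mathbb R^d)$ with continuous embedding $E\to S(\mathbb R^d)$, and let $E'$ be its dual with the strong topology. Let $E\widetilde\otimes E$ be the completed projective tensor product, whose elements $h$ are regarded as functions $h(s,t)$ on $\mathbb R^d\times\mathbb R^d$ by extending $(f\otimes g)(s,t)=f(s)g(t)$ linearly and by continuity. A continuous function $\mu$ is called a pointwise multiplier of a locally convex function space $F$ if $\mu g\in F$ for all $g\in F$ and the map $g\mapsto \mu g$ from $F$ to $F$ is continuous. Let $M(E)$ be the set of pointwise multipliers of $E$, with the topology induced by that of the space $\mathcal L(E)$ of continuous linear operators on $E$ with the topology of uniform convergence on bounded sets. For $f,g\in E$, $v\in E'$ and $s\in\mathbb R^d$ put $$(f\circledast g)(s)=\int_{\mathbb R^d} f(t)\,g(s-t)\,e^{\frac i2\theta(s,t)}\,dt,$$ $$(v\circledast g)(s)=\bigl\langle v,\ e^{\frac i2\theta(s,\cdot)}g(s-\cdot)\bigr\rangle,\qquad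 (g\circledast v)(s)=\bigl\langle v,\ e^{-\frac i2\theta(s,\cdot)}g(s-\cdot)\bigr\rangle .$$ **Theorem 1.** Assume that the function $(s,t)\mapsto e^{-\frac i2\theta(s,t)}$ is a pointwise multiplier of $E\widetilde\otimes E$ and that $h(s,t)\mapsto h(s,s-t)$ is a continuous automorphism of $E\widetilde\otimes E$. Then: 1. $f\circledast g\in E$ for all $f,g\in E$, $E$ is an (associative) algebra under the product $\circledast$, and this product is separately continuous on $E$. 2. For all $g\in E$ and $v\in E'$ the functions $v\circledast g$ and $g\circledast v$ are well defined, i.e. the functions $t\mapsto e^{\pm\frac i2\theta(s,t)}g(s-t)$ belong to $E$ for every $s\in\mathbb R^d$, and $v\circledast g$ and $g\circledast v$ belong to $M(E)$. 3. The maps $(g,v)\mapsto v\circledast g$ and $(g,v)\mapsto g\circledast v$ from $E\times E'$ to $M(E)$ are separately continuous. -/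

import Mathlib

open scoped TensorProduct SchwartzMap

noncomputable section

namespace TwistedConv

/-- The Euclidean space `ℝ^d`. -/
abbrev Pt (d : ℕ) : Type := EuclideanSpace ℝ (Fin d)

/-! ### Nuclear spaces -/

section Nuclear

/-- The vector space `E` equipped with the seminorm `p` in place of its own topology. -/
def WithSeminorm {E : Type*} [AddCommGroup E] [Module ℂ E] (_p : Seminorm ℂ E) : Type _ := E

instance {E : Type*} [AddCommGroup E] [Module ℂ E] (p : Seminorm ℂ E) :
    SeminormedAddCommGroup (WithSeminorm p) :=
  p.toAddGroupSeminorm.toSeminormedAddCommGroup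

instance {E : Type*} [AddCommGroup E] [Module ℂ E] (p : Seminorm ℂ E) :
    Module ℂ (WithSeminorm p) :=
  inferInstanceAs (Module ℂ E)

instance {E : Type*} [AddCommGroup E] [Module ℂ E] (p : Seminorm ℂ E) :
    NormedSpace ℂ (WithSeminorm p) where
  norm_smul_le a x := (map_smul_eq_mul p a x).le

/-- The Banach space `Ê_p`: the Hausdorff completion of `E` for the seminorm `p`. -/
abbrev LocalBanach {E : Type*} [AddCommGroup E] [Module ℂ E] (p : Seminorm ℂ E) : Type _ :=
  UniformSpace.Completion (WithSeminorm p)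

/-- The canonical linear map `E → Ê_p`. -/
def toLocalBanach {E : Type*} [AddCommGroup E] [Module ℂ E] (p : Seminorm ℂ E) :
    E →ₗ[ℂ] LocalBanach p :=
  (UniformSpace.Completion.toComplₗᵢ (𝕜 := ℂ) (E := WithSeminorm p)).toLinearMap

/-- A linear map from a topological vector space to a Banach space is nuclear if it is of the form
`x ↦ ∑ λₙ fₙ(x) yₙ` with `(λₙ)` absolutely summable, `(fₙ)` an equicontinuous sequence of
continuous linear forms and `(yₙ)` a bounded sequence. -/
def IsNuclearMap {E F : Type*} [AddCommGroup E] [Module ℂ E] [TopologicalSpace E]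
    [NormedAddCommGroup F] [NormedSpace ℂ F] (u : E →ₗ[ℂ] F) : Prop :=
  ∃ (c : ℕ → ℂ) (f : ℕ → StrongDual ℂ E) (y : ℕ → F),
    Summable (fun n => ‖c n‖) ∧
    Equicontinuous (fun n x => f n x) ∧
    Bornology.IsBounded (Set.range y) ∧
    ∀ x, HasSum (fun n => (c n * f n x) • y n) (u x)

/-- A locally convex space is nuclear if for each continuous seminorm `p` the canonical map
`E → Ê_p` is nuclear. -/
def IsNuclearSpace (E : Type*) [AddCommGroup E] [Module ℂ E] [TopologicalSpace E] : Prop :=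
  ∀ p : Seminorm ℂ E, Continuous p → IsNuclearMap (toLocalBanach p)

end Nuclear

/-! ### The completed projective tensor product -/

section Tensor

/-- The algebraic tensor product `E ⊗ E`, to be equipped with the projective topology. -/
def ProjTensor (E : Type*) [AddCommGroup E] [Module ℂ E] : Type _ := E ⊗[ℂ] E

instance (E : Type*) [AddCommGroup E] [Module ℂ E] : AddCommGroup (ProjTensor E) :=
  inferInstanceAs (AddCommGroup (E ⊗[ℂ] E))

instance (E : Type*) [AddCommGroup E] [Module ℂ E] : Module ℂ (ProjTensor E) :=
  inferInstanceAs (Module ℂ (E ⊗[ℂ] E))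

/-- The canonical bilinear map `E × E → E ⊗ E`. -/
def projTmul {E : Type*} [AddCommGroup E] [Module ℂ E] : E →ₗ[ℂ] E →ₗ[ℂ] ProjTensor E :=
  TensorProduct.mk ℂ E E

/-- The seminorms on `E ⊗ E` for which the canonical bilinear map `E × E → E ⊗ E` is
continuous. -/
def ProjSeminorm (E : Type*) [AddCommGroup E] [Module ℂ E] [TopologicalSpace E] : Type _ :=
  {r : Seminorm ℂ (ProjTensor E) // Continuous fun x : E × E => r (projTmul x.1 x.2)}

instance (E : Type*) [AddCommGroup E] [Module ℂ E] [TopologicalSpace E] :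
    Nonempty (ProjSeminorm E) :=
  ⟨⟨0, by simpa using continuous_const⟩⟩

/-- The family of all such seminorms. -/
def projSeminormFamily (E : Type*) [AddCommGroup E] [Module ℂ E] [TopologicalSpace E] :
    SeminormFamily ℂ (ProjTensor E) (ProjSeminorm E) :=
  fun r => r.1

/-- The projective topology: the finest locally convex topology on `E ⊗ E` for which the
canonical bilinear map is continuous. -/
instance (E : Type*) [AddCommGroup E] [Module ℂ E] [TopologicalSpace E] :
    TopologicalSpace (ProjTensor E) :=
  (projSeminormFamily E).moduleFilterBasis.topology

theorem projTensor_withSeminorms (E : Type*) [AddCommGroup E] [Module ℂ E]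
    [TopologicalSpace E] : WithSeminorms (projSeminormFamily E) :=
  ⟨rfl⟩

instance (E : Type*) [AddCommGroup E] [Module ℂ E] [TopologicalSpace E] :
    IsTopologicalAddGroup (ProjTensor E) :=
  (projTensor_withSeminorms E).topologicalAddGroup

instance (E : Type*) [AddCommGroup E] [Module ℂ E] [TopologicalSpace E] :
    ContinuousSMul ℂ (ProjTensor E) :=
  (projTensor_withSeminorms E).continuousSMul

instance (E : Type*) [AddCommGroup E] [Module ℂ E] [TopologicalSpace E] :
    UniformSpace (ProjTensor E) :=
  IsTopologicalAddGroup.rightUniformSpace (ProjTensor E)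

instance (E : Type*) [AddCommGroup E] [Module ℂ E] [TopologicalSpace E] :
    IsUniformAddGroup (ProjTensor E) :=
  isUniformAddGroup_of_addCommGroup

instance (E : Type*) [AddCommGroup E] [Module ℂ E] [TopologicalSpace E] :
    UniformContinuousConstSMul ℂ (ProjTensor E) :=
  uniformContinuousConstSMul_of_continuousConstSMul ℂ (ProjTensor E)

/-- The completed projective tensor product of `E` with itself. -/
abbrev CompletedTensor (E : Type*) [AddCommGroup E] [Module ℂ E] [TopologicalSpace E] : Type _ :=
  UniformSpace.Completion (ProjTensor E)

/-- The linear form `u ⊗ v` on `E ⊗ E`. -/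
def tensorLin {E : Type*} [AddCommGroup E] [Module ℂ E] [TopologicalSpace E]
    (u v : StrongDual ℂ E) : ProjTensor E →ₗ[ℂ] ℂ :=
  (TensorProduct.lift
    ((LinearMap.mul ℂ ℂ).compl₁₂ u.toLinearMap v.toLinearMap) : E ⊗[ℂ] E →ₗ[ℂ] ℂ)

theorem tensorLin_tmul {E : Type*} [AddCommGroup E] [Module ℂ E] [TopologicalSpace E]
    (u v : StrongDual ℂ E) (f g : E) : tensorLin u v (projTmul f g) = u f * v g :=
  rfl

theorem continuous_tensorLin {E : Type*} [AddCommGroup E] [Module ℂ E] [TopologicalSpace E]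
    (u v : StrongDual ℂ E) : Continuous (tensorLin u v) := by
  have h : Continuous fun x : E × E =>
      ((normSeminorm ℂ ℂ).comp (tensorLin u v)) (projTmul x.1 x.2) := by
    change Continuous fun x : E × E => ‖u x.1 * v x.2‖
    fun_prop
  let r : ProjSeminorm E := ⟨(normSeminorm ℂ ℂ).comp (tensorLin u v), h⟩
  refine (projTensor_withSeminorms E).continuous_normedSpace_rng ℂ (tensorLin u v) ⟨{r}, 1, ?_⟩
  rw [Finset.sup_singleton, one_smul]
  exact le_rfl

/-- The continuous linear form `u ⊗ v` on `E ⊗ E`, for continuous linear forms `u`, `v` on `E`. -/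
def tensorForm {E : Type*} [AddCommGroup E] [Module ℂ E] [TopologicalSpace E]
    (u v : StrongDual ℂ E) : ProjTensor E →L[ℂ] ℂ :=
  ⟨tensorLin u v, continuous_tensorLin u v⟩

theorem tensorForm_tmul {E : Type*} [AddCommGroup E] [Module ℂ E] [TopologicalSpace E]
    (u v : StrongDual ℂ E) (f g : E) : tensorForm u v (projTmul f g) = u f * v g :=
  rfl

/-- The extension by continuity of `u ⊗ v` to the completed projective tensor product. -/
def completedForm {E : Type*} [AddCommGroup E] [Module ℂ E] [TopologicalSpace E]
    (u v : StrongDual ℂ E) : CompletedTensor E → ℂ :=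
  UniformSpace.Completion.extension (tensorForm u v)

theorem completedForm_coe {E : Type*} [AddCommGroup E] [Module ℂ E] [TopologicalSpace E]
    (u v : StrongDual ℂ E) (w : ProjTensor E) :
    completedForm u v (w : CompletedTensor E) = tensorForm u v w :=
  UniformSpace.Completion.extension_coe (tensorForm u v).uniformContinuous w

end Tensor

/-! ### Spaces of functions and their pointwise multipliers -/

section Multipliers

/-- The evaluation functional `δ_s : f ↦ f(s)` on a space `E` that is embedded by `ι` into the
Schwartz space. -/
def evalAt {d : ℕ} {E : Type*} [AddCommGroup E] [Module ℂ E] [TopologicalSpace E]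
    (ι : E →L[ℂ] 𝓢(Pt d, ℂ)) (s : Pt d) : StrongDual ℂ E :=
  (BoundedContinuousFunction.evalCLM ℂ s).comp
    ((SchwartzMap.toBoundedContinuousFunctionCLM ℂ (Pt d) ℂ).comp ι)

theorem evalAt_apply {d : ℕ} {E : Type*} [AddCommGroup E] [Module ℂ E] [TopologicalSpace E]
    (ι : E →L[ℂ] 𝓢(Pt d, ℂ)) (s : Pt d) (f : E) : evalAt ι s f = ι f s :=
  rfl

/-- The function `h(s,t)` on `ℝ^d × ℝ^d` given by an element `h` of the completed projective tensor
product: for each `(s,t)` it is the continuous extension to the completion of the linear form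
with `f ⊗ g ↦ f(s) g(t)`. -/
def kernelFun {d : ℕ} {E : Type*} [AddCommGroup E] [Module ℂ E] [TopologicalSpace E]
    (ι : E →L[ℂ] 𝓢(Pt d, ℂ)) (h : CompletedTensor E) (z : Pt d × Pt d) : ℂ :=
  completedForm (evalAt ι z.1) (evalAt ι z.2) h

theorem kernelFun_tmul {d : ℕ} {E : Type*} [AddCommGroup E] [Module ℂ E] [TopologicalSpace E]
    (ι : E →L[ℂ] 𝓢(Pt d, ℂ)) (f g : E) (s t : Pt d) :
    kernelFun ι (projTmul f g : ProjTensor E) (s, t) = ι f s * ι g t := by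
  rw [kernelFun, completedForm_coe, tensorForm_tmul, evalAt_apply, evalAt_apply]

/-- Let the elements `g` of a topological vector space `F` be regarded as functions `r g` on `X`.
A continuous function `μ` on `X` is a pointwise multiplier of `F` if multiplication by `μ`
is a continuous linear operator from `F` to `F`. -/
def IsPointwiseMultiplier {X F : Type*} [TopologicalSpace X] [AddCommGroup F] [Module ℂ F]
    [TopologicalSpace F] (r : F → X → ℂ) (μ : X → ℂ) : Prop :=
  Continuous μ ∧ ∃ T : F →L[ℂ] F, ∀ g x, r (T g) x = μ x * r g x

/-- The set `M(E)` of pointwise multipliers of a space `E` that is embedded by `ι` into the Schwartz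
space. -/
def Multiplier {d : ℕ} {E : Type*} [AddCommGroup E] [Module ℂ E] [TopologicalSpace E]
    (ι : E →L[ℂ] 𝓢(Pt d, ℂ)) : Type :=
  {μ : Pt d → ℂ // IsPointwiseMultiplier (fun g : E => ⇑(ι g)) μ}

/-- The operator of multiplication by `μ` on `E`. -/
def Multiplier.toCLM {d : ℕ} {E : Type*} [AddCommGroup E] [Module ℂ E] [TopologicalSpace E]
    {ι : E →L[ℂ] 𝓢(Pt d, ℂ)} (μ : Multiplier ι) : E →L[ℂ] E :=
  μ.2.2.choose

theorem Multiplier.toCLM_apply {d : ℕ} {E : Type*} [AddCommGroup E] [Module ℂ E]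
    [TopologicalSpace E] {ι : E →L[ℂ] 𝓢(Pt d, ℂ)} (μ : Multiplier ι) (g : E) (x : Pt d) :
    ι (μ.toCLM g) x = μ.1 x * ι g x :=
  μ.2.2.choose_spec g x

/-- The topology of `M(E)` is induced by that of the space `L(E)` of continuous linear operators with
the topology of uniform convergence on bounded sets. -/
instance {d : ℕ} {E : Type*} [AddCommGroup E] [Module ℂ E] [TopologicalSpace E]
    [IsTopologicalAddGroup E] [ContinuousConstSMul ℂ E] (ι : E →L[ℂ] 𝓢(Pt d, ℂ)) :
    TopologicalSpace (Multiplier ι) :=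
  TopologicalSpace.induced Multiplier.toCLM inferInstance

end Multipliers

/-! ### Twisted convolution -/

section Twisted

/-- The phase factor `e^{i c θ(s,t)}`. -/
def phase {d : ℕ} (θ : LinearMap.BilinForm ℝ (Pt d)) (c : ℝ) (s t : Pt d) : ℂ :=
  Complex.exp (Complex.I * (c * θ s t : ℝ))

/-- The twisted convolution `(f ⊛_θ g)(s) = ∫ f(t) g(s - t) e^{(i/2) θ(s,t)} dt`. -/
def twistedConv {d : ℕ} (θ : LinearMap.BilinForm ℝ (Pt d)) (f g : 𝓢(Pt d, ℂ)) (s : Pt d) : ℂ :=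
  ∫ t, f t * g (s - t) * phase θ (1 / 2) s t

end Twisted

end TwistedConv

end

open TwistedConv

/-! Everything is obtained by slicing. If Φ acts on the completed tensor product by h(s,t) ↦ φ(s,t)
h(s,s-t), then Φ(f ⊗ g)(s,t) = f(s) φ(s,t) g(s-t). Slicing the first variable by δ_s, with f(s) = 1,
puts φ(s,·) g(s-·) in E. Slicing the second by v gives f(s)⟨v, φ(s,·) g(s-·)⟩, so multiplication by
the twisted convolution of v and g is the continuous operator `sliceOp Φ g v`
(`exists_multiplier_of_kernel`). A suitable f exists because the points at which not all of E
vanishes form an open subgroup of ℝ^d (`exists_apply_eq_one`).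

Continuity in g comes from joint continuity of ⊗ at 0, and continuity in v from the equicontinuity
of slices (`exists_nhds_sliceFst_le`). For f ⊛ g the slicing form is integration, and the required
changes of variables are composed of h(s,s-t) and the flip (`exists_twistedMul`). Associativity is
Fubini plus a cocycle identity for the phase. -/

noncomputable section

open scoped Topology Pointwise

namespace TwistedConv

/-! ### Slice maps on the completed projective tensor product -/

section Slices

variable {E : Type*} [AddCommGroup E] [Module ℂ E]

theorem projTensor_induction {motive : ProjTensor E → Prop} (z : ProjTensor E)
    (zero : motive 0) (tmul : ∀ f g : E, motive (projTmul f g))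
    (add : ∀ x y, motive x → motive y → motive (x + y)) : motive z :=
  TensorProduct.induction_on (motive := motive) z zero tmul add

/-- The flip `f ⊗ g ↦ g ⊗ f` on the algebraic tensor product. -/
def projFlip : ProjTensor E →ₗ[ℂ] ProjTensor E :=
  ((TensorProduct.comm ℂ E E).toLinearMap : E ⊗[ℂ] E →ₗ[ℂ] E ⊗[ℂ] E)

/-- Hahn–Banach: a seminorm is the supremum of the linear forms it dominates. -/
theorem exists_linearForm_of_seminorm (p : Seminorm ℂ E) (x : E) :
    ∃ w : E →ₗ[ℂ] ℂ, (∀ y, ‖w y‖ ≤ p y) ∧ w x = p x := by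
  obtain ⟨g, hg, hgx⟩ := exists_dual_vector'' ℂ (E := WithSeminorm p) x
  exact ⟨g.toLinearMap, fun y => (g.le_of_opNorm_le hg y).trans (one_mul _).le, hgx⟩

section TVS

variable [TopologicalSpace E]

/-- Universal property of the projective topology: a continuous seminorm of the target pulls back to
one of the defining seminorms. -/
theorem continuous_projTensor {F : Type*} [AddCommGroup F] [Module ℂ F] [TopologicalSpace F]
    [PolynormableSpace ℂ F] (T : ProjTensor E →ₗ[ℂ] F)
    (h : Continuous fun x : E × E => T (projTmul x.1 x.2)) : Continuous T := by
  refine WithSeminorms.continuous_of_isBounded (projTensor_withSeminorms E)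
    (PolynormableSpace.withSeminorms ℂ F) T fun p => ?_
  have hp : Continuous fun x : E × E => (p.1.comp T) (projTmul x.1 x.2) :=
    p.2.comp h
  let r : ProjSeminorm E := ⟨p.1.comp T, hp⟩
  refine ⟨{r}, 1, ?_⟩
  rw [Finset.sup_singleton, one_smul]
  exact le_rfl

/-- The slice map `f ⊗ g ↦ w(f) g` on the algebraic tensor product. -/
def projSlice (w : StrongDual ℂ E) : ProjTensor E →ₗ[ℂ] E :=
  (TensorProduct.lift ((LinearMap.lsmul ℂ E).comp w.toLinearMap) : E ⊗[ℂ] E →ₗ[ℂ] E)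

theorem projSlice_tmul (w : StrongDual ℂ E) (f g : E) : projSlice w (projTmul f g) = w f • g :=
  rfl

theorem continuous_projFlip : Continuous (projFlip : ProjTensor E →ₗ[ℂ] ProjTensor E) := by
  refine WithSeminorms.continuous_of_isBounded (projTensor_withSeminorms E)
    (projTensor_withSeminorms E) projFlip fun p => ?_
  have hp : Continuous fun x : E × E => (p.1.comp projFlip) (projTmul x.1 x.2) :=
    p.2.comp continuous_swap
  let r : ProjSeminorm E := ⟨p.1.comp projFlip, hp⟩
  refine ⟨{r}, 1, ?_⟩
  rw [Finset.sup_singleton, one_smul]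
  exact le_rfl

/-- The flip `h(s,t) ↦ h(t,s)` on the completed tensor product. -/
def tensorFlip : CompletedTensor E →L[ℂ] CompletedTensor E :=
  ContinuousLinearMap.completion ⟨projFlip, continuous_projFlip⟩

theorem tensorFlip_tmul (f g : E) :
    tensorFlip (projTmul f g : ProjTensor E) =
      ((projTmul g f : ProjTensor E) : CompletedTensor E) :=
  ContinuousLinearMap.completion_apply_coe _ _

/-- Elementary tensors span a dense subspace, so the slice identities below need checking only on
them. -/
theorem completedTensor_ext {F : Type*} [AddCommGroup F] [Module ℂ F] [TopologicalSpace F]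
    [T2Space F] {T S : CompletedTensor E →L[ℂ] F}
    (h : ∀ f g : E, T (projTmul f g : ProjTensor E) = S (projTmul f g : ProjTensor E)) :
    T = S := by
  ext K
  induction K using UniformSpace.Completion.induction_on with
  | hp => exact isClosed_eq T.continuous S.continuous
  | ih z =>
    induction z using projTensor_induction with
    | zero => rw [UniformSpace.Completion.coe_zero, map_zero, map_zero]
    | tmul f g => exact h f g
    | add x y hx hy => rw [UniformSpace.Completion.coe_add, map_add, map_add, hx, hy]

/-- The continuous linear extension of `u ⊗ v` to the completed tensor product. -/
def completedFormCLM (u v : StrongDual ℂ E) : StrongDual ℂ (CompletedTensor E) :=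
  (tensorForm u v).fromCompletion

theorem completedFormCLM_apply (u v : StrongDual ℂ E) (K : CompletedTensor E) :
    completedFormCLM u v K = completedForm u v K :=
  rfl

theorem completedForm_tmul (u v : StrongDual ℂ E) (f g : E) :
    completedForm u v (projTmul f g : ProjTensor E) = u f * v g := by
  rw [completedForm_coe, tensorForm_tmul]

theorem completedForm_tensorFlip (u v : StrongDual ℂ E) (K : CompletedTensor E) :
    completedForm u v (tensorFlip K) = completedForm v u K := by
  have : (completedFormCLM u v).comp tensorFlip = completedFormCLM v u := by
    refine completedTensor_ext fun f g => ?_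
    rw [ContinuousLinearMap.comp_apply, tensorFlip_tmul, completedFormCLM_apply,
      completedFormCLM_apply, completedForm_tmul, completedForm_tmul, mul_comm]
  exact DFunLike.congr_fun this K

theorem tendsto_projTmul :
    Filter.Tendsto (fun x : E × E => projTmul x.1 x.2) (𝓝 0) (𝓝 (0 : ProjTensor E)) := by
  rw [(projTensor_withSeminorms E).tendsto_nhds _ 0]
  intro r ε hε
  have h := r.2.tendsto 0
  simp only [Prod.fst_zero, Prod.snd_zero, map_zero] at h
  simp only [sub_zero]
  exact h.eventually_lt_const hε

/-- The map `g ↦ f ⊗ g` to the completed tensor product. -/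
def tmulLeft [IsTopologicalAddGroup E] (f : E) : E →L[ℂ] CompletedTensor E where
  toFun g := (projTmul f g : ProjTensor E)
  map_add' x y := by rw [map_add, UniformSpace.Completion.coe_add]
  map_smul' c x := by rw [map_smul, UniformSpace.Completion.coe_smul]; rfl
  cont := by
    refine (UniformSpace.Completion.continuous_coe _).comp
      (continuous_of_continuousAt_zero (projTmul f) ?_)
    rw [ContinuousAt, map_zero, (projTensor_withSeminorms E).tendsto_nhds _ 0]
    intro r ε hε
    have h : Filter.Tendsto (fun g => r.1 (projTmul f g)) (𝓝 0) (𝓝 (r.1 (projTmul f 0))) :=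
      (r.2.comp (Continuous.prodMk_right f)).tendsto 0
    rw [map_zero, map_zero] at h
    simp only [sub_zero]
    exact h.eventually_lt_const hε

theorem tmulLeft_apply [IsTopologicalAddGroup E] (f g : E) :
    tmulLeft f g = ((projTmul f g : ProjTensor E) : CompletedTensor E) :=
  rfl

/-- The map `f ↦ f ⊗ g` to the completed tensor product. -/
def tmulRight [IsTopologicalAddGroup E] (g : E) : E →L[ℂ] CompletedTensor E :=
  tensorFlip.comp (tmulLeft g)

theorem tmulRight_apply [IsTopologicalAddGroup E] (f g : E) :
    tmulRight g f = ((projTmul f g : ProjTensor E) : CompletedTensor E) :=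
  tensorFlip_tmul g f

theorem exists_strongDual_of_seminorm [IsTopologicalAddGroup E] {p : Seminorm ℂ E}
    (hp : Continuous p) (x : E) :
    ∃ w : StrongDual ℂ E, (∀ y, ‖w y‖ ≤ p y) ∧ w x = p x := by
  obtain ⟨w, hw, hwx⟩ := exists_linearForm_of_seminorm p x
  refine ⟨⟨w, ?_⟩, hw, hwx⟩
  refine continuous_of_continuousAt_zero w ?_
  rw [ContinuousAt, map_zero]
  refine squeeze_zero_norm hw ?_
  simpa using hp.tendsto 0

end TVS

theorem continuous_projSlice [TopologicalSpace E] [ContinuousSMul ℂ E] [PolynormableSpace ℂ E]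
    (w : StrongDual ℂ E) : Continuous (projSlice w) :=
  continuous_projTensor _ (by simp only [projSlice_tmul]; fun_prop)

variable [UniformSpace E] [IsUniformAddGroup E] [ContinuousSMul ℂ E] [PolynormableSpace ℂ E]
  [CompleteSpace E] [T0Space E]

/-- The slice map `f ⊗ g ↦ w(f) g` on the completed tensor product. -/
def sliceFst (w : StrongDual ℂ E) : CompletedTensor E →L[ℂ] E :=
  have := uniformContinuousConstSMul_of_continuousConstSMul ℂ E
  ContinuousLinearMap.fromCompletion ⟨projSlice w, continuous_projSlice w⟩

theorem sliceFst_coe (w : StrongDual ℂ E) (z : ProjTensor E) : sliceFst w z = projSlice w z :=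
  UniformSpace.Completion.extension_coe
    (⟨projSlice w, continuous_projSlice w⟩ : ProjTensor E →L[ℂ] E).uniformContinuous z

theorem sliceFst_tmul (w : StrongDual ℂ E) (f g : E) :
    sliceFst w (projTmul f g : ProjTensor E) = w f • g := by
  rw [sliceFst_coe, projSlice_tmul]

/-- The slice map `f ⊗ g ↦ v(g) f` on the completed tensor product. -/
def sliceSnd (v : StrongDual ℂ E) : CompletedTensor E →L[ℂ] E :=
  (sliceFst v).comp tensorFlip

theorem sliceSnd_apply (v : StrongDual ℂ E) (K : CompletedTensor E) :
    sliceSnd v K = sliceFst v (tensorFlip K) :=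
  rfl

theorem apply_sliceFst (u w : StrongDual ℂ E) (K : CompletedTensor E) :
    u (sliceFst w K) = completedForm w u K := by
  have : u.comp (sliceFst w) = completedFormCLM w u := by
    refine completedTensor_ext fun f g => ?_
    rw [ContinuousLinearMap.comp_apply, sliceFst_tmul, completedFormCLM_apply,
      completedForm_tmul, map_smul, smul_eq_mul]
  exact DFunLike.congr_fun this K

/-- An abstract Fubini rule: the two variables may be sliced in either order. It turns evaluation of
a slice by v at a point into v applied to a function. -/
theorem apply_sliceSnd (v w : StrongDual ℂ E) (K : CompletedTensor E) :
    w (sliceSnd v K) = v (sliceFst w K) := by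
  rw [sliceSnd_apply, apply_sliceFst, completedForm_tensorFlip, apply_sliceFst]

theorem sliceFst_add (v w : StrongDual ℂ E) : sliceFst (v + w) = sliceFst v + sliceFst w := by
  refine completedTensor_ext fun f g => ?_
  rw [add_apply, sliceFst_tmul, sliceFst_tmul, sliceFst_tmul,
    add_apply, add_smul]

theorem sliceSnd_add (v w : StrongDual ℂ E) : sliceSnd (v + w) = sliceSnd v + sliceSnd w := by
  rw [sliceSnd, sliceFst_add, ContinuousLinearMap.add_comp]; rfl

/-- The slice maps of an equicontinuous set of linear forms are equicontinuous. -/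
theorem exists_nhds_sliceFst_le {p q : Seminorm ℂ E} (hp : Continuous p) (hq : Continuous q) :
    ∃ N ∈ 𝓝 (0 : CompletedTensor E), ∀ w : StrongDual ℂ E, (∀ y, ‖w y‖ ≤ p y) →
      ∀ K ∈ N, q (sliceFst w K) ≤ 1 := by
  let ℱ : {w : StrongDual ℂ E // ∀ y, ‖w y‖ ≤ p y} → Seminorm ℂ (ProjTensor E) :=
    fun w => q.comp (projSlice w.1)
  have htmul : ∀ w f g, ℱ w (projTmul f g) ≤ p f * q g := fun w f g => by
    change q (w.1 f • g) ≤ _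
    rw [map_smul_eq_mul]
    exact mul_le_mul_of_nonneg_right (w.2 f) (apply_nonneg q g)
  -- The supremum of the family is the expected seminorm only if it is finite at every tensor; the
  -- bound may depend on the tensor.
  have hbdd : BddAbove (Set.range ℱ) := by
    rw [Seminorm.bddAbove_range_iff]
    intro z
    induction z using projTensor_induction with
    | zero => exact ⟨0, by rintro _ ⟨w, rfl⟩; simp⟩
    | tmul f g => exact ⟨p f * q g, by rintro _ ⟨w, rfl⟩; exact htmul w f g⟩
    | add x y hx hy =>
      obtain ⟨a, ha⟩ := hx
      obtain ⟨b, hb⟩ := hy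
      refine ⟨a + b, ?_⟩
      rintro _ ⟨w, rfl⟩
      exact (map_add_le_add _ _ _).trans (add_le_add (ha ⟨w, rfl⟩) (hb ⟨w, rfl⟩))
  let r : Seminorm ℂ (ProjTensor E) := ⨆ w, ℱ w
  have hle : ∀ w z, ℱ w z ≤ r z := fun w z => (le_ciSup hbdd w : ℱ w ≤ r) z
  have : Nonempty {w : StrongDual ℂ E // ∀ y, ‖w y‖ ≤ p y} := ⟨⟨0, fun y => by simp⟩⟩
  have hr : ∀ f g, r (projTmul f g) ≤ p f * q g := fun f g => by
    rw [Seminorm.iSup_apply hbdd]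
    exact ciSup_le fun w => htmul w f g
  have htend : Filter.Tendsto (fun x : E × E => p x.1 * q x.2) (𝓝 0) (𝓝 0) := by
    have : Continuous fun x : E × E => p x.1 * q x.2 := by fun_prop
    simpa using this.tendsto 0
  -- Continuity is needed at every (f, g), not only at 0: the difference of two elementary tensors
  -- splits bilinearly, and `hr` bounds both terms.
  have hcont : Continuous fun x : E × E => r (projTmul x.1 x.2) := by
    rw [continuous_iff_continuousAt]
    rintro ⟨f, g⟩
    rw [ContinuousAt, tendsto_iff_norm_sub_tendsto_zero]
    have hb : Continuous fun x : E × E =>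
        p (x.1 - f) * q x.2 + p f * q (x.2 - g) := by fun_prop
    have hb0 := hb.tendsto (f, g)
    simp only [sub_self, map_zero, zero_mul, mul_zero, add_zero] at hb0
    refine squeeze_zero (fun _ => norm_nonneg _) (fun x => ?_) hb0
    have hx : projTmul x.1 x.2 - projTmul f g
        = projTmul (x.1 - f) x.2 + projTmul f (x.2 - g) := by
      simp only [map_sub, LinearMap.sub_apply]; abel
    calc ‖r (projTmul x.1 x.2) - r (projTmul f g)‖
        ≤ r (projTmul x.1 x.2 - projTmul f g) := abs_sub_map_le_sub r _ _
      _ ≤ _ := by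
        rw [hx]
        exact (map_add_le_add r _ _).trans (add_le_add (hr _ _) (hr _ _))
  let r' : ProjSeminorm E := ⟨r, hcont⟩
  have hrc : Continuous r := (projTensor_withSeminorms E).continuous_seminorm r'
  -- The closure of the unit ball of r is a neighbourhood of 0 in the completion, and the bound on
  -- slices survives the closure by continuity.
  refine ⟨closure ((↑) '' {z : ProjTensor E | r z ≤ 1}), ?_, fun w hw K hK => ?_⟩
  · refine UniformSpace.Completion.isDenseInducing_coe.closure_image_mem_nhds ?_
    have h0 := hrc.tendsto 0
    rw [map_zero] at h0
    exact h0.eventually_le_const one_pos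
  · refine closure_minimal (t := {K | q (sliceFst w K) ≤ 1}) ?_
      (isClosed_le (hq.comp (sliceFst w).continuous) continuous_const) hK
    rintro _ ⟨z, hz, rfl⟩
    rw [Set.mem_ofPred_eq, sliceFst_coe]
    exact (hle ⟨w, hw⟩ z).trans hz

end Slices

/-! ### Separate continuity of the slice operators in g and v -/

section SliceOperators

theorem exists_seminorm_lt_one_subset {F : Type*} [AddCommGroup F] [Module ℂ F]
    [TopologicalSpace F] [PolynormableSpace ℂ F] {V : Set F} (hV : V ∈ 𝓝 (0 : F)) :
    ∃ p : Seminorm ℂ F, Continuous p ∧ ∀ x, p x < 1 → x ∈ V := by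
  have hF := PolynormableSpace.withSeminorms ℂ F
  have := hF.topologicalAddGroup
  obtain ⟨⟨I, r⟩, hr, hV⟩ := hF.hasBasis_zero_ball.mem_iff.1 hV
  have hr' : (0 : ℝ) < r := hr
  refine ⟨r.toNNReal⁻¹ • I.sup fun p => p.1, ?_, fun x hx => hV ?_⟩
  · exact (Seminorm.continuous_finsetSup fun p _ => p.2).const_smul (r.toNNReal⁻¹)
  · rw [Seminorm.mem_ball_zero]
    rw [smul_apply, NNReal.smul_def, NNReal.coe_inv, Real.coe_toNNReal _ hr'.le,
      smul_eq_mul, inv_mul_lt_iff₀ hr', mul_one] at hx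
    exact hx

theorem _root_.Bornology.IsVonNBounded.exists_subset_smul {F : Type*} [AddCommGroup F] [Module ℂ F]
    [TopologicalSpace F] {S V : Set F} (hS : Bornology.IsVonNBounded ℂ S) (hV : V ∈ 𝓝 (0 : F)) :
    ∃ a : ℂ, a ≠ 0 ∧ ∀ x ∈ S, ∃ y ∈ V, x = a • y := by
  have h : ∀ᶠ a in Bornology.cobounded ℂ, S ⊆ a • V := hS hV
  obtain ⟨a, ha, ha0⟩ := (h.and (Bornology.eventually_ne_cobounded 0)).exists
  refine ⟨a, ha0, fun x hx => ?_⟩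
  obtain ⟨y, hy, rfl⟩ := ha hx
  exact ⟨y, hy, rfl⟩

theorem tendsto_apply_projTmul {E : Type*} [AddCommGroup E] [Module ℂ E] [TopologicalSpace E]
    {F : Type*} [AddCommGroup F] [Module ℂ F] [TopologicalSpace F]
    (T : CompletedTensor E →L[ℂ] F) :
    Filter.Tendsto (fun x : E × E => T (projTmul x.1 x.2 : ProjTensor E))
      (𝓝 0 ×ˢ 𝓝 0) (𝓝 0) := by
  have hT : Continuous fun K : ProjTensor E => T K :=
    T.continuous.comp (UniformSpace.Completion.continuous_coe _)
  have h0 := hT.tendsto 0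
  rw [UniformSpace.Completion.coe_zero, map_zero] at h0
  rw [← nhds_prod_eq]
  exact h0.comp tendsto_projTmul

theorem continuous_of_tendsto_zero {G H : Type*} [AddGroup G] [TopologicalSpace G]
    [IsTopologicalAddGroup G] [AddGroup H] [TopologicalSpace H] [IsTopologicalAddGroup H]
    (F : G → H) (hadd : ∀ x y, F (x + y) = F x + F y) (h : Filter.Tendsto F (𝓝 0) (𝓝 0)) :
    Continuous F := by
  let L : G →+ H := AddMonoidHom.mk' F hadd
  refine continuous_of_continuousAt_zero L ?_
  rw [ContinuousAt, map_zero]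
  exact h

variable {E : Type*} [AddCommGroup E] [Module ℂ E]
  [UniformSpace E] [IsUniformAddGroup E] [ContinuousSMul ℂ E] [PolynormableSpace ℂ E]
  [CompleteSpace E] [T0Space E]

/-- The operator `f ↦ (id ⊗ v)(Φ(f ⊗ g))` on `E`. -/
def sliceOp (Φ : CompletedTensor E →L[ℂ] CompletedTensor E) (g : E) (v : StrongDual ℂ E) :
    E →L[ℂ] E :=
  (sliceSnd v).comp (Φ.comp (tmulRight g))

theorem sliceOp_apply (Φ : CompletedTensor E →L[ℂ] CompletedTensor E) (g : E)
    (v : StrongDual ℂ E) (f : E) :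
    sliceOp Φ g v f = sliceSnd v (Φ (projTmul f g : ProjTensor E)) := by
  rw [← tmulRight_apply]; rfl


theorem continuous_sliceOp_left (Φ : CompletedTensor E →L[ℂ] CompletedTensor E)
    (v : StrongDual ℂ E) : Continuous fun g => sliceOp Φ g v := by
  have hadd : ∀ g h, sliceOp Φ (g + h) v = sliceOp Φ g v + sliceOp Φ h v := fun g h => by
    ext f
    simp only [add_apply, sliceOp_apply]
    rw [map_add, UniformSpace.Completion.coe_add, map_add, map_add]
  suffices h : Filter.Tendsto (fun g => sliceOp Φ g v) (𝓝 0) (𝓝 0) from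
    continuous_of_tendsto_zero (fun g => sliceOp Φ g v) hadd h
  rw [ContinuousLinearMap.hasBasis_nhds_zero.tendsto_right_iff]
  rintro ⟨S, U⟩ ⟨hS, hU⟩
  obtain ⟨V, hV, W, hW, hVW⟩ :=
    Filter.mem_prod_iff.1 (tendsto_apply_projTmul ((sliceSnd v).comp Φ) hU)
  obtain ⟨a, ha, hSV⟩ := hS.exists_subset_smul hV
  have hsm : Filter.Tendsto (fun g : E => a • g) (𝓝 0) (𝓝 0) := by
    simpa only [smul_zero] using (continuous_const_smul a).tendsto (0 : E)
  filter_upwards [hsm hW] with g hg f hf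
  obtain ⟨y, hy, rfl⟩ := hSV f hf
  -- The scalar absorbing the bounded set S crosses the tensor sign, so it is enough that a • g be
  -- small.
  have hmove : projTmul (a • y) g = projTmul y (a • g) := by
    rw [LinearMap.map_smul, LinearMap.smul_apply, LinearMap.map_smul]
  rw [sliceOp_apply, hmove]
  have hmem := hVW (Set.mk_mem_prod hy hg)
  rw [Set.mem_preimage, ContinuousLinearMap.comp_apply] at hmem
  exact hmem

theorem continuous_sliceOp_right (Φ : CompletedTensor E →L[ℂ] CompletedTensor E) (g : E) :
    Continuous fun v : StrongDual ℂ E => sliceOp Φ g v := by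
  refine continuous_of_tendsto_zero _ (fun v w => ?_) ?_
  · ext f
    simp only [add_apply, sliceOp_apply, sliceSnd_add]
  rw [ContinuousLinearMap.hasBasis_nhds_zero.tendsto_right_iff]
  rintro ⟨S, U⟩ ⟨hS, hU⟩
  obtain ⟨p, hp, hpU⟩ := exists_seminorm_lt_one_subset hU
  -- Since w(`sliceOp Φ g v f`) = v(`sliceFst w` (Φ(f ⊗ g))), smallness of v on D bounds p(`sliceOp
  -- Φ g v f`) for f in S. For the strong topology D must be bounded, which follows from
  -- equicontinuity of the slices.
  let D : Set E := {x | ∃ w : StrongDual ℂ E, (∀ y, ‖w y‖ ≤ p y) ∧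
    ∃ f ∈ S, x = sliceFst w (Φ (projTmul f g : ProjTensor E))}
  have hC : Bornology.IsVonNBounded ℂ
      ((Φ.comp (tmulRight g)) '' S) := hS.image (Φ.comp (tmulRight g))
  have hD : Bornology.IsVonNBounded ℂ D := by
    rw [(PolynormableSpace.withSeminorms ℂ E).isVonNBounded_iff_seminorm_bounded]
    rintro ⟨q, hq⟩
    obtain ⟨N, hN, hNle⟩ := exists_nhds_sliceFst_le hp hq
    obtain ⟨a, ha, hCN⟩ := hC.exists_subset_smul hN
    refine ⟨‖a‖ + 1, by positivity, ?_⟩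
    rintro _ ⟨w, hw, f, hf, rfl⟩
    obtain ⟨K, hK, hfK⟩ := hCN _ ⟨f, hf, rfl⟩
    rw [ContinuousLinearMap.comp_apply, tmulRight_apply] at hfK
    rw [hfK, map_smul]
    calc q (a • sliceFst w K) = ‖a‖ * q (sliceFst w K) := map_smul_eq_mul q a _
      _ ≤ ‖a‖ * 1 := mul_le_mul_of_nonneg_left (hNle w hw K hK) (norm_nonneg a)
      _ < ‖a‖ + 1 := by linarith
  filter_upwards [ContinuousLinearMap.eventually_nhds_zero_mapsTo hD
    (Metric.ball_mem_nhds (0 : ℂ) one_pos)] with v hv f hf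
  refine hpU _ ?_
  -- A Hahn–Banach form attaining p at this vector converts the bound for v on D into a bound for p.
  obtain ⟨w, hw, hwe⟩ := exists_strongDual_of_seminorm hp (sliceOp Φ g v f)
  have hvw := hv ⟨w, hw, f, hf, rfl⟩
  rw [← apply_sliceSnd, ← sliceOp_apply] at hvw
  rw [hwe, mem_ball_zero_iff, Complex.norm_real, Real.norm_of_nonneg (apply_nonneg p _)] at hvw
  exact hvw

end SliceOperators

/-! ### Kernels as functions, and multipliers obtained by slicing -/

section Functions

variable {d : ℕ} {E : Type*} [AddCommGroup E] [Module ℂ E]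

theorem kernelFun_tensorFlip [TopologicalSpace E] (ι : E →L[ℂ] 𝓢(Pt d, ℂ)) (K : CompletedTensor E)
    (s t : Pt d) : kernelFun ι (tensorFlip K) (s, t) = kernelFun ι K (t, s) :=
  completedForm_tensorFlip _ _ K

/-- The operator behind `toCLM` is a chosen one; injectivity of ι makes it unique, so the topology
of M(E) can be tested on `sliceOp`. -/
theorem Multiplier.toCLM_eq [TopologicalSpace E] {ι : E →L[ℂ] 𝓢(Pt d, ℂ)}
    (hι : Function.Injective ι) (μ : Multiplier ι) (T : E →L[ℂ] E)
    (hT : ∀ f x, ι (T f) x = μ.1 x * ι f x) : μ.toCLM = T := by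
  ext f
  refine hι (SchwartzMap.ext fun x => ?_)
  rw [μ.toCLM_apply, hT]

variable [UniformSpace E] [IsUniformAddGroup E] [ContinuousSMul ℂ E] [PolynormableSpace ℂ E]
  [CompleteSpace E] [T0Space E] (ι : E →L[ℂ] 𝓢(Pt d, ℂ))

theorem apply_sliceFst_evalAt (K : CompletedTensor E) (s t : Pt d) :
    ι (sliceFst (evalAt ι s) K) t = kernelFun ι K (s, t) := by
  rw [← evalAt_apply ι, apply_sliceFst]; rfl

theorem apply_sliceSnd_evalAt (K : CompletedTensor E) (s t : Pt d) :
    ι (sliceSnd (evalAt ι t) K) s = kernelFun ι K (s, t) := by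
  rw [sliceSnd_apply, apply_sliceFst_evalAt, kernelFun_tensorFlip]

theorem apply_sliceSnd_eq (v : StrongDual ℂ E) (K : CompletedTensor E) (s : Pt d) :
    ι (sliceSnd v K) s = v (sliceFst (evalAt ι s) K) := by
  rw [← evalAt_apply ι, apply_sliceSnd]

/-- If `h(s,t) ↦ h(s,s-t)` acts on the completed tensor product of a nontrivial space `E`, then the
functions of `E` have no common zeros. -/
theorem exists_apply_eq_one [Nontrivial E] (hι : Function.Injective ι)
    (R : CompletedTensor E → CompletedTensor E)
    (hR : ∀ h s t, kernelFun ι (R h) (s, t) = kernelFun ι h (s, s - t)) (s : Pt d) :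
    ∃ f : E, ι f s = 1 := by
  let Z : Set (Pt d) := {s | ∃ f : E, ι f s ≠ 0}
  have hsub : ∀ a ∈ Z, ∀ b ∈ Z, a - b ∈ Z := by
    rintro a ⟨f, hf⟩ b ⟨g, hg⟩
    -- At a - b this slice takes the value f(a) g(a - (a - b)) = f(a) g(b).
    refine ⟨sliceFst (evalAt ι a) (R (projTmul f g : ProjTensor E)), ?_⟩
    rw [apply_sliceFst_evalAt, hR, kernelFun_tmul, sub_sub_cancel]
    exact mul_ne_zero hf hg
  have hne : Z.Nonempty := by
    obtain ⟨f, hf⟩ := exists_ne (0 : E)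
    by_contra hZ
    refine hf (hι (SchwartzMap.ext fun x => ?_))
    by_contra hx
    refine hZ ⟨x, f, fun h => hx ?_⟩
    rw [h, map_zero]; rfl
  have hopen : IsOpen Z := by
    have : Z = ⋃ f : E, {s | ι f s ≠ 0} := by ext s; simp [Z]
    rw [this]
    exact isOpen_iUnion fun f => isOpen_ne_fun (ι f).continuous continuous_const
  let H : AddSubgroup (Pt d) :=
    AddSubgroup.ofSub Z hne fun a ha b hb => by rw [← sub_eq_add_neg]; exact hsub a ha b hb
  -- An open subgroup is closed, and ℝ^d is connected.
  have hclosed : IsClosed Z := H.isClosed_of_isOpen hopen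
  have huniv : Z = Set.univ := IsClopen.eq_univ ⟨hclosed, hopen⟩ hne
  obtain ⟨f, hf⟩ : s ∈ Z := huniv ▸ Set.mem_univ s
  refine ⟨(ι f s)⁻¹ • f, ?_⟩
  rw [map_smul, smul_apply, smul_eq_mul, inv_mul_cancel₀ hf]

/-- If `h(s,t) ↦ φ(s,t) h(s,s-t)` acts continuously on the completed tensor product, then the
functions `t ↦ φ(s,t) g(s-t)` belong to `E` and pairing them with `v ∈ E'` gives multipliers of `E`
depending separately continuously on `g` and `v`. -/
theorem exists_multiplier_of_kernel (hι : Function.Injective ι)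
    (hone : ∀ s, ∃ f : E, ι f s = 1)
    (φ : Pt d → Pt d → ℂ) (Φ : CompletedTensor E →L[ℂ] CompletedTensor E)
    (hΦ : ∀ h s t, kernelFun ι (Φ h) (s, t) = φ s t * kernelFun ι h (s, s - t)) :
    ∃ A : Pt d → E → E, (∀ s g t, ι (A s g) t = φ s t * ι g (s - t)) ∧
      ∃ P : E → StrongDual ℂ E → Multiplier ι, (∀ g v s, (P g v).1 s = v (A s g)) ∧
        (∀ v, Continuous fun g => P g v) ∧ (∀ g, Continuous fun v => P g v) := by
  choose e he using hone
  let A : Pt d → E → E := fun s g =>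
    sliceFst (evalAt ι s) (Φ (projTmul (e s) g : ProjTensor E))
  have hA : ∀ s g t, ι (A s g) t = φ s t * ι g (s - t) := fun s g t => by
    rw [apply_sliceFst_evalAt, hΦ, kernelFun_tmul, he, one_mul]
  have hop : ∀ g v f s, ι (sliceOp Φ g v f) s = v (A s g) * ι f s := fun g v f s => by
    have h : sliceFst (evalAt ι s) (Φ (projTmul f g : ProjTensor E)) = ι f s • A s g := by
      refine hι (SchwartzMap.ext fun t => ?_)
      rw [apply_sliceFst_evalAt, hΦ, kernelFun_tmul, map_smul, smul_apply, hA,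
        smul_eq_mul, mul_left_comm]
    rw [sliceOp_apply, apply_sliceSnd_eq, h, map_smul, smul_eq_mul, mul_comm]
  have hcont : ∀ (g : E) (v : StrongDual ℂ E), Continuous fun s => v (A s g) := fun g v => by
    rw [continuous_iff_continuousAt]
    intro s
    have hs : ι (e s) s ≠ 0 := by rw [he]; exact one_ne_zero
    -- With e s held fixed while x varies, the multiplier is near s a quotient of two Schwartz
    -- functions with nonvanishing denominator.
    have hq : ContinuousAt (fun x => ι (sliceOp Φ g v (e s)) x / ι (e s) x) s :=
      (ι (sliceOp Φ g v (e s))).continuous.continuousAt.div (ι (e s)).continuous.continuousAt hs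
    refine hq.congr ?_
    filter_upwards [(ι (e s)).continuous.continuousAt.eventually_ne hs] with x hx
    rw [hop, mul_div_cancel_right₀ _ hx]
  let P : E → StrongDual ℂ E → Multiplier ι := fun g v =>
    ⟨fun s => v (A s g), hcont g v, sliceOp Φ g v, hop g v⟩
  have hP : ∀ g v, (P g v).toCLM = sliceOp Φ g v := fun g v =>
    (P g v).toCLM_eq hι _ (hop g v)
  refine ⟨A, hA, P, fun _ _ _ => rfl, fun v => ?_, fun g => ?_⟩
  · refine continuous_induced_rng.2 ?_
    simp only [Function.comp_def, hP]
    exact continuous_sliceOp_left Φ v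
  · refine continuous_induced_rng.2 ?_
    simp only [Function.comp_def, hP]
    exact continuous_sliceOp_right Φ g

end Functions

/-! ### Associativity of the twisted convolution -/

section Associativity

open MeasureTheory

variable {d : ℕ} {θ : LinearMap.BilinForm ℝ (Pt d)}

theorem continuous_phase (c : ℝ) : Continuous fun z : Pt d × Pt d => phase θ c z.1 z.2 := by
  have h : Continuous fun z : Pt d × Pt d => θ z.1 z.2 := by
    have := (LinearMap.toContinuousBilinearMap θ).continuous₂
    exact this
  unfold phase
  fun_prop

theorem norm_phase (c : ℝ) (s t : Pt d) : ‖phase θ c s t‖ = 1 := by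
  rw [phase, mul_comm, Complex.norm_exp_ofReal_mul_I]

theorem phase_swap (hθ : θ.IsAlt) (c : ℝ) (s t : Pt d) : phase θ (-c) t s = phase θ c s t := by
  rw [phase, phase, ← hθ.neg_eq s t]
  congr 3
  ring

/-- The 2-cocycle identity of the phase, in the variables left after the substitution r = u + t.
Both exponents are θ(u,t) + θ(s,u) + θ(s,t) up to the factor ic. -/
theorem phase_mul_phase_sub (hθ : θ.IsAlt) (c : ℝ) (s t u : Pt d) :
    phase θ c (u + t) t * phase θ c s (u + t) = phase θ c (s - t) u * phase θ c s t := by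
  simp only [phase]
  rw [← Complex.exp_add, ← Complex.exp_add, ← mul_add, ← mul_add, ← Complex.ofReal_add,
    ← Complex.ofReal_add]
  congr 3
  simp only [map_add, map_sub, LinearMap.add_apply, LinearMap.sub_apply, hθ.self_eq_zero t]
  rw [← hθ.neg_eq u t]
  ring

theorem twistedConv_assoc (hθ : θ.IsAlt) (f g h F G : 𝓢(Pt d, ℂ))
    (hF : ∀ s, F s = twistedConv θ f g s) (hG : ∀ s, G s = twistedConv θ g h s) (s : Pt d) :
    twistedConv θ F h s = twistedConv θ f G s := by
  let k : Pt d → Pt d → ℂ := fun r t =>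
    f t * g (r - t) * (phase θ (1 / 2) r t * h (s - r) * phase θ (1 / 2) s r)
  -- The factor f(t) g(r-t) is integrable as a convolution integrand; the phases have modulus one
  -- and h is bounded.
  have hk : Integrable (Function.uncurry k) (volume.prod volume) := by
    have hfg : Integrable (fun p : Pt d × Pt d => f p.2 * g (p.1 - p.2))
        (volume.prod volume) :=
      f.integrable.convolution_integrand (ContinuousLinearMap.mul ℂ ℂ) g.integrable
    refine hfg.mul_bdd (c := SchwartzMap.seminorm ℝ 0 0 h) ?_ (Filter.Eventually.of_forall ?_)
    · have h1 := continuous_phase (θ := θ) (1 / 2)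
      have h2 : Continuous fun p : Pt d × Pt d => phase θ (1 / 2) s p.1 :=
        h1.comp (continuous_const.prodMk continuous_fst)
      have h3 : Continuous fun p : Pt d × Pt d => h (s - p.1) :=
        h.continuous.comp (continuous_const.sub continuous_fst)
      exact ((h1.mul h3).mul h2).aestronglyMeasurable
    · intro p
      rw [norm_mul, norm_mul, norm_phase, norm_phase, one_mul, mul_one]
      exact h.norm_le_seminorm ℝ _
  calc twistedConv θ F h s = ∫ r, ∫ t, k r t := by
        refine integral_congr_ae (Filter.Eventually.of_forall fun r => ?_)
        simp only [hF, twistedConv, k]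
        rw [mul_assoc, ← integral_mul_const]
        congr 1 with t
        ring
    _ = ∫ t, ∫ r, k r t := integral_integral_swap hk
    _ = ∫ t, ∫ u, k (u + t) t := by
        congr 1 with t
        exact (integral_add_right_eq_self (fun r => k r t) t).symm
    _ = twistedConv θ f G s := by
        refine integral_congr_ae (Filter.Eventually.of_forall fun t => ?_)
        simp only [hG, twistedConv, k]
        rw [← integral_const_mul, ← integral_mul_const]
        congr 1 with u
        rw [add_sub_cancel_right, sub_sub, add_comm t u]
        linear_combination (f t * g u * h (s - (u + t))) *
          phase_mul_phase_sub hθ (1 / 2) s t u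

end Associativity

/-! ### Twisted convolution as a product on E -/

section Algebra

variable {d : ℕ} {E : Type*} [AddCommGroup E] [Module ℂ E]

/-- Integration over `ℝ^d` as a continuous linear form on `E`. -/
def integralForm [TopologicalSpace E] (ι : E →L[ℂ] 𝓢(Pt d, ℂ)) : StrongDual ℂ E :=
  (SchwartzMap.integralCLM ℂ MeasureTheory.volume).comp ι

theorem integralForm_apply [TopologicalSpace E] (ι : E →L[ℂ] 𝓢(Pt d, ℂ)) (f : E) : integralForm ι f = ∫ t, ι f t :=
  rfl

variable [UniformSpace E] [IsUniformAddGroup E] [ContinuousSMul ℂ E] [PolynormableSpace ℂ E]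
  [CompleteSpace E] [T0Space E] (ι : E →L[ℂ] 𝓢(Pt d, ℂ))

/-- If `h(s,t) ↦ h(s,s-t)` and multiplication by `e^{iθ/2}` act continuously on the completed tensor
product, then twisted convolution is a separately continuous bilinear operation on `E`. -/
theorem exists_twistedMul
    (hone : ∀ s, ∃ f : E, ι f s = 1) (θ : LinearMap.BilinForm ℝ (Pt d))
    (M R : CompletedTensor E →L[ℂ] CompletedTensor E)
    (hM : ∀ h s t, kernelFun ι (M h) (s, t) = phase θ (1 / 2) s t * kernelFun ι h (s, t))
    (hR : ∀ h s t, kernelFun ι (R h) (s, t) = kernelFun ι h (s, s - t)) :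
    ∃ mul : E →ₗ[ℂ] E →ₗ[ℂ] E,
      (∀ f g s, ι (mul f g) s = twistedConv θ (ι f) (ι g) s) ∧
      (∀ f, Continuous fun g => mul f g) ∧ (∀ g, Continuous fun f => mul f g) := by
  obtain ⟨e, he⟩ := hone 0
  -- The coordinate change h(s-t,-t) leaves f(-t) where f(t) is wanted, hence the reflection N
  -- below.
  let T : CompletedTensor E →L[ℂ] CompletedTensor E := R.comp (tensorFlip.comp R)
  have hT : ∀ h s t, kernelFun ι (T h) (s, t) = kernelFun ι h (s - t, -t) := fun h s t => by
    change kernelFun ι (R (tensorFlip (R h))) (s, t) = _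
    rw [hR, kernelFun_tensorFlip, hR, sub_sub_cancel_left]
  -- The second variable is set to 0, which reads T(e ⊗ f) on the diagonal: T(e ⊗ f)(s,s) = e(0)
  -- f(-s), with e(0) = 1.
  let N : E →L[ℂ] E :=
    (sliceSnd (evalAt ι 0)).comp ((R.comp (tensorFlip.comp T)).comp (tmulLeft e))
  have hN : ∀ f s, ι (N f) s = ι f (-s) := fun f s => by
    change ι (sliceSnd (evalAt ι 0) (R (tensorFlip (T (projTmul e f : ProjTensor E))))) s = _
    rw [apply_sliceSnd_evalAt, hR, kernelFun_tensorFlip, hT, kernelFun_tmul, sub_zero, sub_self, he,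
      one_mul]
  let Φ : CompletedTensor E →L[ℂ] CompletedTensor E := M.comp T
  have hΦ : ∀ f g s t, kernelFun ι (Φ (projTmul g (N f) : ProjTensor E)) (s, t) =
      ι f t * ι g (s - t) * phase θ (1 / 2) s t := fun f g s t => by
    change kernelFun ι (M (T _)) (s, t) = _
    rw [hM, hT, kernelFun_tmul, hN, neg_neg]
    ring
  let L : E → E →L[ℂ] E := fun f => sliceOp Φ (N f) (integralForm ι)
  have hL : ∀ f g s, ι (L f g) s = twistedConv θ (ι f) (ι g) s := fun f g s => by
    change ι (sliceOp Φ (N f) (integralForm ι) g) s = _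
    rw [sliceOp_apply, apply_sliceSnd_eq, integralForm_apply]
    simp only [apply_sliceFst_evalAt, hΦ]
    rfl
  let mul : E →ₗ[ℂ] E →ₗ[ℂ] E := LinearMap.mk₂ ℂ (fun f g => L f g)
    (fun f₁ f₂ g => by
      simp only [L, sliceOp_apply]
      rw [map_add, map_add, UniformSpace.Completion.coe_add, map_add, map_add])
    (fun c f g => by
      simp only [L, sliceOp_apply]
      rw [map_smul, map_smul, UniformSpace.Completion.coe_smul, map_smul, map_smul])
    (fun f g₁ g₂ => map_add (L f) g₁ g₂)
    (fun c f g => map_smul (L f) c g)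
  refine ⟨mul, hL, fun f => (L f).continuous, fun g => ?_⟩
  -- For fixed g the product is a composite of continuous maps in f, as f enters only through g ⊗ N
  -- f.
  have hc : Continuous fun f : E => (sliceSnd (integralForm ι)) (Φ (tmulLeft g (N f))) :=
    (sliceSnd (integralForm ι)).continuous.comp
      (Φ.continuous.comp ((tmulLeft g).continuous.comp N.continuous))
  refine hc.congr fun f => ?_
  rw [tmulLeft_apply, ← sliceOp_apply]
  rfl

end Algebra

end TwistedConv

end

/-! ### The main theorem -/

theorem theorem1 {d : ℕ} {E : Type*} [AddCommGroup E] [Module ℂ E]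
    -- `E` is a complete nuclear barrelled locally convex space
    [UniformSpace E] [IsUniformAddGroup E] [ContinuousSMul ℂ E] [PolynormableSpace ℂ E]
    [CompleteSpace E] [BarrelledSpace ℂ E] (hnuc : IsNuclearSpace E)
    -- `E` is a vector subspace of the Schwartz space, continuously embedded by `ι`
    (ι : E →L[ℂ] 𝓢(Pt d, ℂ)) (hι : Function.Injective ι)
    -- `θ` is a symplectic form
    (θ : LinearMap.BilinForm ℝ (Pt d)) (hθ_alt : θ.IsAlt) (hθ_nondeg : θ.Nondegenerate)
    -- the function `e^{-iθ/2}` is a pointwise multiplier of the completed tensor product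
    (hmul : IsPointwiseMultiplier (kernelFun ι) (fun z => phase θ (-(1 / 2)) z.1 z.2))
    -- `h(s,t) ↦ h(s,s-t)` is a continuous automorphism of the completed tensor product
    (haut : ∃ R : CompletedTensor E ≃L[ℂ] CompletedTensor E,
      ∀ h s t, kernelFun ι (R h) (s, t) = kernelFun ι h (s, s - t)) :
    -- `E` is an algebra under the twisted convolution, with separately continuous product
    (∃ mul : E →ₗ[ℂ] E →ₗ[ℂ] E,
      (∀ f g s, ι (mul f g) s = twistedConv θ (ι f) (ι g) s) ∧
      (∀ f g h, mul (mul f g) h = mul f (mul g h)) ∧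
      (∀ f, Continuous fun g => mul f g) ∧
      (∀ g, Continuous fun f => mul f g)) ∧
    -- the functions `t ↦ e^{± iθ(s,t)/2} g(s-t)` belong to `E`
    ∃ A B : Pt d → E → E,
      (∀ s g t, ι (A s g) t = phase θ (1 / 2) s t * ι g (s - t)) ∧
      (∀ s g t, ι (B s g) t = phase θ (-(1 / 2)) s t * ι g (s - t)) ∧
      -- `P g v = v ⊛ g` and `Q g v = g ⊛ v` belong to `M(E)`
      ∃ P Q : E → StrongDual ℂ E → Multiplier ι,
        (∀ g v s, (P g v).1 s = v (A s g)) ∧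
        (∀ g v s, (Q g v).1 s = v (B s g)) ∧
        -- separate continuity, `E'` having the strong topology
        (∀ v, Continuous fun g => P g v) ∧ (∀ g, Continuous fun v => P g v) ∧
        (∀ v, Continuous fun g => Q g v) ∧ (∀ g, Continuous fun v => Q g v) := by
  have : T2Space E := .of_injective_continuous hι ι.continuous
  -- The zero space has no function with value 1 at a point, so it is settled separately with the
  -- zero multiplier.
  rcases subsingleton_or_nontrivial E with hE | hE
  · have hzero : ∀ f : E, ι f = 0 := fun f => by rw [Subsingleton.elim f 0, map_zero]
    let z : Multiplier ι := ⟨fun _ => 0, continuous_const, 0, fun g x => by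
      change ι (0 : E) x = 0 * ι g x
      rw [hzero, zero_mul]; rfl⟩
    have hA : ∀ (φ : ℂ) (g : E) (x y : Pt d), ι (0 : E) x = φ * ι g y := fun φ g x y => by
      rw [hzero, hzero, zero_apply, zero_apply, mul_zero]
    refine ⟨⟨0, fun f g s => ?_, fun _ _ _ => Subsingleton.elim _ _, fun _ => continuous_const,
      fun _ => continuous_const⟩, fun _ _ => 0, fun _ _ => 0, fun _ _ _ => hA _ _ _ _,
      fun _ _ _ => hA _ _ _ _, fun _ _ => z, fun _ _ => z, fun _ v _ => (map_zero v).symm,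
      fun _ v _ => (map_zero v).symm, fun _ => continuous_const, fun _ => continuous_const,
      fun _ => continuous_const, fun _ => continuous_const⟩
    rw [hzero, hzero, twistedConv]
    simp
  · obtain ⟨R, hR⟩ := haut
    obtain ⟨-, M, hM⟩ := hmul
    replace hM : ∀ h s t, kernelFun ι (M h) (s, t) =
      phase θ (-(1 / 2)) s t * kernelFun ι h (s, t) := fun h s t => hM h (s, t)
    have hone := exists_apply_eq_one ι hι R hR
    -- Conjugating by the flip exchanges s and t, and skew-symmetry of θ then reverses the sign of
    -- the phase.
    let M' : CompletedTensor E →L[ℂ] CompletedTensor E := tensorFlip.comp (M.comp tensorFlip)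
    have hM' : ∀ h s t,
        kernelFun ι (M' h) (s, t) = phase θ (1 / 2) s t * kernelFun ι h (s, t) := fun h s t => by
      change kernelFun ι (tensorFlip (M (tensorFlip h))) (s, t) = _
      rw [kernelFun_tensorFlip, hM, kernelFun_tensorFlip, phase_swap hθ_alt]
    obtain ⟨mul, hmulconv, hc₁, hc₂⟩ := exists_twistedMul ι hone θ M' R hM' hR
    obtain ⟨A, hA, P, hP, hP₁, hP₂⟩ := exists_multiplier_of_kernel ι hι hone
      (phase θ (1 / 2)) (M'.comp R.toContinuousLinearMap) fun h s t => by
        rw [ContinuousLinearMap.comp_apply, hM', ContinuousLinearEquiv.coe_coe, hR]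
    obtain ⟨B, hB, Q, hQ, hQ₁, hQ₂⟩ := exists_multiplier_of_kernel ι hι hone
      (phase θ (-(1 / 2))) (M.comp R.toContinuousLinearMap) fun h s t => by
        rw [ContinuousLinearMap.comp_apply, hM, ContinuousLinearEquiv.coe_coe, hR]
    refine ⟨⟨mul, hmulconv, fun f g h => hι (SchwartzMap.ext fun s => ?_), hc₁, hc₂⟩,
      A, B, hA, hB, P, Q, hP, hQ, hP₁, hP₂, hQ₁, hQ₂⟩
    rw [hmulconv, hmulconv]
    exact twistedConv_assoc hθ_alt _ _ _ _ _ (hmulconv f g) (hmulconv g h) s
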